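/- A pseudo hoop is an algebra $(M;\odot,\rightarrow,\rightsquigarrow,1)$ of type $\langle 2,2,2,0\rangle$ such that for all $x,y,z\in M$: $x\odot 1=x=1\odot x$; $x\rightarrow x=1=x\rightsquigarrow x$; $(x\odot y)\rightarrow z=x\rightarrow(y\rightarrow z)$; $(x\odot y)\rightsquigarrow z=y\rightsquigarrow(x\rightsquigarrow z)$; and $(x\rightarrow y)\odot x=(y\rightarrow x)\odot y=x\odot(x\rightsquigarrow y)=y\odot(y\rightsquigarrow x)$. It is partially ordered by $x\le y$ iff $x\rightarrow y=1$. It is representable if it is (isomorphic to) a subdirect product of linearly ordered pseudo hoops, and basic if $(x\rightarrow y)\rightarrow z\le((y\rightarrow x)\rightarrow z)\rightarrow z$ and $(x\rightsquigarrow y)\rightsquigarrow z\le((y\rightsquigarrow x)\rightsquigarrow z)\rightsquigarrow z$ for all $x,y,z\in M$. A filter is a nonempty subset of $M$ that is closed under $\odot$ and upward closed. A value of $g\in M\setminus\{1\}$ is a filter $V$ that is maximal among the filters not containing $g$; its cover $V^*$ is the filter generated by $V\cup\{g\}$. The value $V$ is normal in $V^*$ if for all $x,y\in V^*$ one has $x\rightarrow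 y\in V$ iff $x\rightsquigarrow y\in V$. A pseudo hoop is normal-valued if it is basic and every value in it is normal in its cover. Corollary 6.13. Every representable pseudo hoop is normal-valued; that is, it is basic and each of its values is normal in its cover. -/

import Mathlib

universe u v w

/-- A pseudo hoop: an algebra `(M; ⊙, →, ⇝, 1)` of type `⟨2, 2, 2, 0⟩`, where `⊙` is written `*`,
the first implication `→` is written `⇾` and the second one is written `⇝`. (Associativity of `*`
is a consequence of the axioms.) -/
class PseudoHoop (M : Type*) extends Mul M, One M where
  /-- The implication `x → y`. -/
  limp : M → M → M
  /-- The implication `x ⇝ y`. -/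
  rimp : M → M → M
  mul_one' : ∀ x : M, x * 1 = x
  one_mul' : ∀ x : M, 1 * x = x
  limp_self : ∀ x : M, limp x x = 1
  rimp_self : ∀ x : M, rimp x x = 1
  mul_limp : ∀ x y z : M, limp (x * y) z = limp x (limp y z)
  mul_rimp : ∀ x y z : M, rimp (x * y) z = rimp y (rimp x z)
  limp_mul_comm : ∀ x y : M, limp x y * x = limp y x * y
  limp_mul_eq_mul_rimp : ∀ x y : M, limp y x * y = x * rimp x y
  mul_rimp_comm : ∀ x y : M, x * rimp x y = y * rimp y x

infixr:65 " ⇾ " => PseudoHoop.limp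
infixr:65 " ⇝ " => PseudoHoop.rimp

namespace PseudoHoop

/-- The natural order of a pseudo hoop: `x ≤ y` iff `x → y = 1`. -/
instance instLE (M : Type*) [PseudoHoop M] : LE M := ⟨fun x y => x ⇾ y = 1⟩

/-- The direct product of a family of pseudo hoops, with componentwise operations. -/
instance instPi {ι : Type*} (C : ι → Type*) [∀ i, PseudoHoop (C i)] :
    PseudoHoop (∀ i, C i) where
  toMul := Pi.instMul
  toOne := Pi.instOne
  limp f g := fun i => f i ⇾ g i
  rimp f g := fun i => f i ⇝ g i
  mul_one' f := funext fun i => mul_one' (f i)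
  one_mul' f := funext fun i => one_mul' (f i)
  limp_self f := funext fun i => limp_self (f i)
  rimp_self f := funext fun i => rimp_self (f i)
  mul_limp f g h := funext fun i => mul_limp (f i) (g i) (h i)
  mul_rimp f g h := funext fun i => mul_rimp (f i) (g i) (h i)
  limp_mul_comm f g := funext fun i => limp_mul_comm (f i) (g i)
  limp_mul_eq_mul_rimp f g := funext fun i => limp_mul_eq_mul_rimp (f i) (g i)
  mul_rimp_comm f g := funext fun i => mul_rimp_comm (f i) (g i)

/-- A map between pseudo hoops that preserves all the operations. -/
structure IsHom {M N : Type*} [PseudoHoop M] [PseudoHoop N] (φ : M → N) : Prop where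
  map_one : φ 1 = 1
  map_mul : ∀ x y : M, φ (x * y) = φ x * φ y
  map_limp : ∀ x y : M, φ (x ⇾ y) = φ x ⇾ φ y
  map_rimp : ∀ x y : M, φ (x ⇝ y) = φ x ⇝ φ y

/-- The pseudo hoop `M` is linearly ordered. -/
def IsLinear (M : Type*) [PseudoHoop M] : Prop :=
  ∀ x y : M, x ≤ y ∨ y ≤ x

/-- The pseudo hoop `M` is representable: it is (isomorphic to) a subdirect product of linearly
ordered pseudo hoops, i.e. it embeds into a direct product of linearly ordered pseudo hoops in such
a way that every coordinate projection is onto. -/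
def IsRepresentable (M : Type u) [PseudoHoop M] : Prop :=
  ∃ (ι : Type v) (C : ι → Type w) (_ : ∀ i, PseudoHoop (C i)) (φ : M → ∀ i, C i),
    (∀ i, IsLinear (C i)) ∧ IsHom φ ∧ Function.Injective φ ∧
      ∀ i, Function.Surjective fun x => φ x i

/-- The pseudo hoop `M` is basic. -/
def IsBasic (M : Type*) [PseudoHoop M] : Prop :=
  (∀ x y z : M, (x ⇾ y) ⇾ z ≤ ((y ⇾ x) ⇾ z) ⇾ z) ∧
    ∀ x y z : M, (x ⇝ y) ⇝ z ≤ ((y ⇝ x) ⇝ z) ⇝ z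

variable {M : Type*} [PseudoHoop M]

/-- A (nonempty) filter of a pseudo hoop. -/
structure IsFilter (F : Set M) : Prop where
  one_mem : (1 : M) ∈ F
  mul_mem : ∀ x y : M, x ∈ F → y ∈ F → x * y ∈ F
  mem_of_le : ∀ x y : M, x ≤ y → x ∈ F → y ∈ F

/-- The filter generated by a set: the intersection of all filters that contain it. -/
def generatedFilter (S : Set M) : Set M :=
  {x | ∀ F : Set M, IsFilter F → S ⊆ F → x ∈ F}

/-- `V` is a value of `g`: a filter that is maximal with respect to not containing `g`.
(This forces `g ≠ 1`.) -/
def IsValue (V : Set M) (g : M) : Prop :=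
  Maximal (fun F : Set M => IsFilter F ∧ g ∉ F) V

/-- The cover of a value `V` of `g`: the filter generated by `V` and `g`. -/
def cover (V : Set M) (g : M) : Set M :=
  generatedFilter (insert g V)

/-- The filter `V` is normal in the filter `W`, i.e. `V` is a normal filter of the pseudo hoop `W`:
for all `x, y ∈ W`, `x → y ∈ V` iff `x ⇝ y ∈ V`. -/
def IsNormalIn (V W : Set M) : Prop :=
  ∀ x ∈ W, ∀ y ∈ W, (x ⇾ y ∈ V ↔ x ⇝ y ∈ V)

/-- The pseudo hoop `M` is normal-valued: it is basic and every value is normal in its cover. -/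
def IsNormalValued (M : Type*) [PseudoHoop M] : Prop :=
  IsBasic M ∧ ∀ (V : Set M) (g : M), IsValue V g → IsNormalIn V (cover V g)

end PseudoHoop

namespace PseudoHoop

/-! ### Order, residuation and filters -/

section Basic

variable {M : Type*} [PseudoHoop M]

/-! Basicness is checked coordinatewise. For normality, a value `V` is prime for a term `join` that
computes maxima in chains, so the sets where a given `x ∉ V` differs from `1` generate a proper
filter on the index set. Modulo an ultrafilter above it, `M` becomes a chain, and the kernel of the
quotient map lies in `V`; hence `V` descends to a value of that chain (`IsHom.isNormalIn_cover`).

In a chain, each `c ∉ V` has a power below any given element of the cover. The crux is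
`IsLinear.rimp_mul_mem`: conjugating `v ∈ V` past `x` in the cover stays in `V`. Failure would make
`x * x` idempotent, and a double negation relative to it then gives a contradiction. -/

theorem le_def {x y : M} : x ≤ y ↔ x ⇾ y = 1 := Iff.rfl

theorem eq_of_limp_eq_one {x y : M} (h : x ⇾ y = 1) (h' : y ⇾ x = 1) : x = y := by
  have := limp_mul_comm x y
  rwa [h, h', one_mul', one_mul'] at this

theorem one_limp (x : M) : 1 ⇾ x = x := by
  have key : ∀ y : M, y ⇾ (1 ⇾ x) = y ⇾ x := fun y => by rw [← mul_limp, mul_one']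
  exact eq_of_limp_eq_one (by rw [← key, limp_self]) (by rw [key, limp_self])

theorem one_rimp (x : M) : 1 ⇝ x = x := by
  have h := limp_mul_eq_mul_rimp (1 : M) x
  rw [one_mul', ← limp_mul_comm, mul_one', one_limp] at h
  exact h.symm

theorem limp_one (x : M) : x ⇾ 1 = 1 := by
  have h : (x ⇾ 1) * x = x := by rw [limp_mul_comm, one_limp, mul_one']
  calc x ⇾ 1 = (x ⇾ 1) * x ⇾ 1 := by rw [h]
    _ = 1 := by rw [mul_limp, limp_self]

theorem rimp_one (x : M) : x ⇝ 1 = 1 := by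
  have h : x * (x ⇝ 1) = x := by rw [mul_rimp_comm, one_rimp, one_mul']
  calc x ⇝ 1 = x * (x ⇝ 1) ⇝ 1 := by rw [h]
    _ = 1 := by rw [mul_rimp, rimp_self]

theorem le_iff_rimp {x y : M} : x ≤ y ↔ x ⇝ y = 1 := by
  rw [le_def]
  constructor <;> intro h
  · have hx : y * (y ⇝ x) = x := by
      rw [← limp_mul_eq_mul_rimp, h, one_mul']
    rw [← hx, mul_rimp, rimp_self, rimp_one]
  · have hx : (y ⇾ x) * y = x := by
      rw [limp_mul_eq_mul_rimp, h, mul_one']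
    rw [← hx, mul_limp, limp_self, limp_one]

instance : PartialOrder M where
  le := (· ≤ ·)
  le_refl := limp_self
  le_trans x y z h h' := by
    have hx : (y ⇾ x) * y = x := by
      rw [← limp_mul_comm, le_def.1 h, one_mul']
    rw [le_def] at *
    rw [← hx, mul_limp, h', limp_one]
  le_antisymm _ _ := eq_of_limp_eq_one

theorem mul_le_iff_le_limp {x y z : M} : x * y ≤ z ↔ x ≤ y ⇾ z := by
  rw [le_def, le_def, mul_limp]

theorem mul_le_iff_le_rimp {x y z : M} : x * y ≤ z ↔ y ≤ x ⇝ z := by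
  rw [le_iff_rimp, le_iff_rimp, mul_rimp]

theorem le_one (x : M) : x ≤ 1 := limp_one x

/-- Both bracketings have the same implications into every `w`, and these determine an element by
antisymmetry. -/
instance instMonoid : Monoid M where
  mul_assoc x y z := by
    have key : ∀ w : M, x * y * z ⇾ w = x * (y * z) ⇾ w := fun w => by simp only [mul_limp]
    exact eq_of_limp_eq_one (by rw [key, limp_self]) (by rw [← key, limp_self])
  one_mul := one_mul'
  mul_one := mul_one'

instance : MulLeftMono M where
  elim _ _ _ h := mul_le_iff_le_rimp.2 (h.trans (mul_le_iff_le_rimp.1 le_rfl))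

instance : MulRightMono M where
  elim _ _ _ h := mul_le_iff_le_limp.2 (h.trans (mul_le_iff_le_limp.1 le_rfl))

theorem mul_le_left (x y : M) : x * y ≤ x := by
  simpa using mul_le_mul_right (le_one y) x

theorem mul_le_right (x y : M) : x * y ≤ y := by
  simpa using mul_le_mul_left (le_one x) y

theorem mul_rimp_le (x y : M) : x * (x ⇝ y) ≤ y := mul_le_iff_le_rimp.2 le_rfl

theorem limp_mul_le (x y : M) : (x ⇾ y) * x ≤ y := mul_le_iff_le_limp.2 le_rfl

theorem mul_rimp_of_le {x y : M} (h : y ≤ x) : x * (x ⇝ y) = y := by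
  rw [mul_rimp_comm, le_iff_rimp.1 h, mul_one]

theorem rimp_mono {x y z : M} (h : y ≤ z) : x ⇝ y ≤ x ⇝ z :=
  mul_le_iff_le_rimp.1 ((mul_rimp_le x y).trans h)

theorem rimp_anti {x y z : M} (h : x ≤ y) : y ⇝ z ≤ x ⇝ z :=
  mul_le_iff_le_rimp.1 ((mul_le_mul_left h _).trans (mul_rimp_le y z))

theorem le_rimp (x y : M) : y ≤ x ⇝ y := mul_le_iff_le_rimp.1 (mul_le_right x y)

theorem le_limp (x y : M) : y ≤ x ⇾ y := mul_le_iff_le_limp.1 (mul_le_left y x)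

theorem IsLinear.isBasic (h : IsLinear M) : IsBasic M := by
  refine ⟨fun x y z => ?_, fun x y z => ?_⟩ <;> rcases h x y with h | h
  · rw [le_def.1 h, one_limp]
    exact le_limp _ _
  · rw [le_def.1 h, one_limp, limp_self]
    exact le_one _
  · rw [le_iff_rimp.1 h, one_rimp]
    exact le_rimp _ _
  · rw [le_iff_rimp.1 h, one_rimp, rimp_self]
    exact le_one _

theorem IsFilter.pow_mem {V : Set M} (hV : IsFilter V) {v : M} (hv : v ∈ V) (n : ℕ) :
    v ^ n ∈ V := by
  induction n with
  | zero => simpa using hV.one_mem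
  | succ n ih => rw [pow_succ]; exact hV.mul_mem _ _ ih hv

theorem isFilter_powers (c : M) : IsFilter {z : M | ∃ n : ℕ, c ^ n ≤ z} where
  one_mem := ⟨0, le_one _⟩
  mul_mem := by
    rintro x y ⟨m, hm⟩ ⟨n, hn⟩
    exact ⟨m + n, by rw [pow_add]; exact mul_le_mul' hm hn⟩
  mem_of_le := fun x y h ⟨n, hn⟩ => ⟨n, hn.trans h⟩

theorem isFilter_generatedFilter (S : Set M) : IsFilter (generatedFilter S) where
  one_mem _ hF _ := hF.one_mem
  mul_mem _ _ hx hy F hF h := hF.mul_mem _ _ (hx F hF h) (hy F hF h)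
  mem_of_le _ _ hxy hx F hF h := hF.mem_of_le _ _ hxy (hx F hF h)

theorem generatedFilter_subset {S F : Set M} (hF : IsFilter F) (h : S ⊆ F) :
    generatedFilter S ⊆ F := fun _ hx => hx F hF h

/-- A filter that properly contains a value of `g` contains `g`. -/
theorem IsValue.mem_of_subset {V F : Set M} {g c : M} (hV : IsValue V g) (hF : IsFilter F)
    (h : V ⊆ F) (hc : c ∈ F) (hcV : c ∉ V) : g ∈ F := by
  by_contra hg
  exact hcV (hV.2 ⟨hF, hg⟩ h hc)

end Basic

/-! ### Values in chains -/

section Linear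

variable {M : Type*} [PseudoHoop M]

/-- The double negation with respect to an idempotent is submultiplicative in a chain. -/
theorem IsLinear.rimp_rimp_mul_le (hM : IsLinear M) {e : M} (he : e * e = e) (x y : M) :
    (x * y ⇝ e) ⇝ e ≤ ((x ⇝ e) ⇝ e) * ((y ⇝ e) ⇝ e) := by
  rcases hM y (x ⇝ e) with h | h
  · rw [mul_rimp, le_iff_rimp.1 h, one_rimp]
    calc e = e * e := he.symm
      _ ≤ _ := mul_le_mul' (le_rimp _ _) (le_rimp _ _)
  -- Here divisibility turns the inequality into an equality: both sides are `p ⇝ e`.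
  · set p := x * y ⇝ e with hp
    have hyp : y * p = x ⇝ e := by rw [hp, mul_rimp, mul_rimp_of_le h]
    have hle : y ⇝ e ≤ p := rimp_anti (mul_le_right x y)
    have hq : p ⇝ (y ⇝ e) = (x ⇝ e) ⇝ e := by rw [← mul_rimp, hyp]
    have hy : (y ⇝ e) ⇝ e = ((x ⇝ e) ⇝ e) ⇝ (p ⇝ e) := by
      rw [← hq, ← mul_rimp, mul_rimp_of_le hle]
    rw [hy, mul_rimp_of_le]
    rw [← hq]
    exact rimp_mono (le_rimp _ _)

theorem IsLinear.rimp_rimp_pow_le (hM : IsLinear M) {e : M} (he : e * e = e) (x : M) (n : ℕ) :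
    (x ^ n ⇝ e) ⇝ e ≤ ((x ⇝ e) ⇝ e) ^ n := by
  induction n with
  | zero => rw [pow_zero, pow_zero]; exact le_one _
  | succ n ih =>
    rw [pow_succ, pow_succ]
    exact (hM.rimp_rimp_mul_le he _ _).trans (mul_le_mul_left ih _)

theorem le_of_pow_le_of_rimp_le {r e : M} (hr : r ⇝ e ≤ e) (n : ℕ) (h : r ^ n ≤ e) : r ≤ e := by
  induction n with
  | zero => exact (le_one r).trans (by simpa using h)
  | succ n ih =>
    rw [pow_succ'] at h
    exact ih ((mul_le_iff_le_rimp.1 h).trans hr)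

/-- If `a = x ⇝ v * x` were outside `V`, then `v ^ n * x = x * a ^ n` would fall below `x * (x * x)`
for some `n`. As `x` lies below all of `V`, this forces `x * x` to be idempotent, and finally `x ≤ v
* x`, so `a = 1`. -/
theorem IsLinear.rimp_mul_mem (hM : IsLinear M) {V : Set M} (hV : IsFilter V) {x v : M}
    (hx : x ∉ V) (harch : ∀ c ∉ V, ∃ n : ℕ, c ^ n ≤ x * x) (hv : v ∈ V) : x ⇝ (v * x) ∈ V := by
  by_contra ha
  have hle : ∀ w ∈ V, x ≤ w := fun w hw =>
    (hM x w).resolve_right fun h => hx (hV.mem_of_le _ _ h hw)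
  set a := x ⇝ (v * x) with ha_def
  have hva : v * x = x * a := (mul_rimp_of_le (mul_le_right v x)).symm
  have hpow : ∀ n : ℕ, v ^ n * x = x * a ^ n := by
    intro n
    induction n with
    | zero => simp
    | succ n ih => rw [pow_succ, pow_succ, mul_assoc, hva, ← mul_assoc, ih, mul_assoc]
  obtain ⟨n, hn⟩ := harch a ha
  have hu : v ^ n ∈ V := hV.pow_mem hv n
  have hux : v ^ n * x ≤ x * (x * x) := by
    rw [hpow]; exact mul_le_mul_right hn x
  set e := x * x with he_def
  have hex : e ≤ x * e := (mul_le_mul_left (hle _ hu) x).trans hux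
  have he : e * e = e := by
    refine le_antisymm (mul_le_left _ _) ?_
    calc e ≤ x * e := hex
      _ ≤ x * (x * e) := mul_le_mul_right hex x
      _ = e * e := by rw [← mul_assoc, ← he_def]
  have hue : v ^ n * x ≤ e := hux.trans (mul_le_right _ _)
  set u := v ^ n
  have hb : x ⇝ e ∉ V := fun h =>
    ha (hV.mem_of_le _ _ (rimp_mono (mul_le_mul_left (hle v hv) x)) h)
  obtain ⟨k, hk⟩ := harch _ hb
  -- The exponent is `k + 1` so that at least one factor `u` is available for `u * x ≤ e` in `hxr`,
  -- even when `k = 0`.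
  have hneg : (u ^ (k + 1) ⇝ e) ⇝ e ≤ e := by
    refine (hM.rimp_rimp_pow_le he u (k + 1)).trans ?_
    have h1 : (u ⇝ e) ⇝ e ≤ x ⇝ e := rimp_anti (mul_le_iff_le_rimp.1 hue)
    have h2 := pow_le_pow_left' h1 (k + 1)
    refine h2.trans ?_
    rw [pow_succ]
    exact (mul_le_left _ _).trans hk
  have hr : u ^ (k + 1) ⇝ e ∉ V := fun h =>
    hx (hV.mem_of_le _ _ ((mul_rimp_le _ _).trans (mul_le_left x x))
      (hV.mul_mem _ _ (hV.pow_mem hu (k + 1)) h))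
  obtain ⟨m, hm⟩ := harch _ hr
  have hre := le_of_pow_le_of_rimp_le hneg m hm
  have hxr : x ≤ u ^ (k + 1) ⇝ e := by
    rw [← mul_le_iff_le_rimp, pow_succ, mul_assoc]
    exact (mul_le_right _ _).trans hue
  have hxv : x ≤ v * x := (hxr.trans hre).trans (mul_le_mul_left (hle v hv) x)
  exact ha (by rw [ha_def, le_iff_rimp.1 hxv]; exact hV.one_mem)

/-- The opposite pseudo hoop: the multiplication is reversed and the implications are swapped. -/
instance instMulOpposite : PseudoHoop Mᵐᵒᵖ where
  toMul := MulOpposite.instMul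
  toOne := MulOpposite.instOne
  limp x y := .op (x.unop ⇝ y.unop)
  rimp x y := .op (x.unop ⇾ y.unop)
  mul_one' x := MulOpposite.unop_injective (one_mul' x.unop)
  one_mul' x := MulOpposite.unop_injective (mul_one' x.unop)
  limp_self x := MulOpposite.unop_injective (rimp_self x.unop)
  rimp_self x := MulOpposite.unop_injective (limp_self x.unop)
  mul_limp x y z := MulOpposite.unop_injective (mul_rimp y.unop x.unop z.unop)
  mul_rimp x y z := MulOpposite.unop_injective (mul_limp y.unop x.unop z.unop)
  limp_mul_comm x y := MulOpposite.unop_injective (mul_rimp_comm x.unop y.unop)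
  limp_mul_eq_mul_rimp x y := MulOpposite.unop_injective <| by
    change y.unop * (y.unop ⇝ x.unop) = (x.unop ⇾ y.unop) * x.unop
    rw [limp_mul_comm, limp_mul_eq_mul_rimp, mul_rimp_comm]
  mul_rimp_comm x y := MulOpposite.unop_injective (limp_mul_comm x.unop y.unop)

theorem op_le_op {x y : M} : MulOpposite.op x ≤ MulOpposite.op y ↔ x ≤ y :=
  (MulOpposite.op_injective.eq_iff (a := x ⇝ y) (b := 1)).trans le_iff_rimp.symm

/-- Reconciles powers in the monoid derived from the opposite pseudo hoop with powers in `M`. -/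
theorem unop_npow (x : Mᵐᵒᵖ) (n : ℕ) :
    (instMonoid.npow n x).unop = x.unop ^ n := by
  induction n with
  | zero =>
    rw [pow_zero]
    exact congrArg MulOpposite.unop (instMonoid.npow_zero x)
  | succ n ih =>
    rw [pow_succ', ← ih]
    exact congrArg MulOpposite.unop (instMonoid.npow_succ n x)

theorem IsLinear.limp_mul_mem (hM : IsLinear M) {V : Set M} (hV : IsFilter V) {x v : M}
    (hx : x ∉ V) (harch : ∀ c ∉ V, ∃ n : ℕ, c ^ n ≤ x * x) (hv : v ∈ V) : x ⇾ (x * v) ∈ V := by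
  have hM' : IsLinear Mᵐᵒᵖ := fun x y => (hM x.unop y.unop).imp op_le_op.2 op_le_op.2
  have hV' : IsFilter (MulOpposite.unop ⁻¹' V : Set Mᵐᵒᵖ) :=
    { one_mem := hV.one_mem
      mul_mem := fun x y hx hy => hV.mul_mem y.unop x.unop hy hx
      mem_of_le := fun x y h hx => hV.mem_of_le x.unop y.unop (op_le_op.1 h) hx }
  refine hM'.rimp_mul_mem hV' (x := .op x) (v := .op v) hx (fun c hc => ?_) hv
  obtain ⟨n, hn⟩ := harch c.unop hc
  exact ⟨n, (op_le_op (x := (instMonoid.npow n c).unop) (y := x * x)).2 (by rwa [unop_npow])⟩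

theorem IsLinear.isNormalIn_cover (hM : IsLinear M) {V : Set M} {g : M} (hV : IsValue V g) :
    IsNormalIn V (cover V g) := by
  have hF : IsFilter V := hV.1.1
  -- In a chain, `c ∉ V` lies below `V`, so the filter of its powers properly contains `V`, hence
  -- contains `g` and the whole cover.
  have harch : ∀ x ∈ cover V g, ∀ c ∉ V, ∃ n : ℕ, c ^ n ≤ x * x := by
    intro x hx c hc
    have hsub : V ⊆ {z : M | ∃ n : ℕ, c ^ n ≤ z} := fun z hz =>
      ⟨1, by
        rw [pow_one]
        exact (hM c z).resolve_right fun h => hc (hF.mem_of_le _ _ h hz)⟩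
    have hg := hV.mem_of_subset (isFilter_powers c) hsub ⟨1, (pow_one c).le⟩ hc
    exact generatedFilter_subset (isFilter_powers c) (Set.insert_subset hg hsub)
      ((isFilter_generatedFilter _).mul_mem _ _ hx hx)
  intro x hx y _
  constructor <;> intro h
  · have hle : x ⇝ (x ⇾ y) * x ≤ x ⇝ y := rimp_mono (limp_mul_le x y)
    refine hF.mem_of_le _ _ hle ?_
    by_cases hxV : x ∈ V
    · exact hF.mem_of_le _ _ (le_rimp _ _) (hF.mul_mem _ _ h hxV)
    · exact hM.rimp_mul_mem hF hxV (harch x hx) h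
  · have hle : x ⇾ x * (x ⇝ y) ≤ x ⇾ y :=
      mul_le_iff_le_limp.1 ((limp_mul_le _ _).trans (mul_rimp_le x y))
    refine hF.mem_of_le _ _ hle ?_
    by_cases hxV : x ∈ V
    · exact hF.mem_of_le _ _ (le_limp _ _) (hF.mul_mem _ _ hxV h)
    · exact hM.limp_mul_mem hF hxV (harch x hx) h

end Linear

/-! ### Transfer of values along surjections -/

section Hom

variable {M N : Type*} [PseudoHoop M] [PseudoHoop N] {φ : M → N}

theorem IsHom.monotone (hφ : IsHom φ) {x y : M} (h : x ≤ y) : φ x ≤ φ y := by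
  rw [le_def, ← hφ.map_limp, le_def.1 h, hφ.map_one]

theorem IsHom.isFilter_preimage (hφ : IsHom φ) {F : Set N} (hF : IsFilter F) :
    IsFilter (φ ⁻¹' F) where
  one_mem := by rw [Set.mem_preimage, hφ.map_one]; exact hF.one_mem
  mul_mem x y hx hy := by rw [Set.mem_preimage, hφ.map_mul]; exact hF.mul_mem _ _ hx hy
  mem_of_le x y h hx := hF.mem_of_le _ _ (hφ.monotone h) hx

/-- If `φ` is onto and the kernel of `φ` lies in a value `V`, then `V` is normal in its cover as
soon as its image, which is a value too, is. -/
theorem IsHom.isNormalIn_cover (hφ : IsHom φ) (hsurj : Function.Surjective φ) {V : Set M} {g : M}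
    (hV : IsValue V g) (hker : ∀ x, φ x = 1 → x ∈ V)
    (hN : ∀ (W : Set N) (h : N), IsValue W h → IsNormalIn W (cover W h)) :
    IsNormalIn V (cover V g) := by
  have hF : IsFilter V := hV.1.1
  -- The kernel condition makes `V` saturated, so it is the full preimage of its image.
  have hmem : ∀ x y, y ∈ V → φ y ≤ φ x → x ∈ V := by
    intro x y hy h
    have h1 : y ⇾ x ∈ V := hker _ (by rw [hφ.map_limp, le_def.1 h])
    exact hF.mem_of_le _ _ (limp_mul_le y x) (hF.mul_mem _ _ h1 hy)
  have himg : ∀ x, φ x ∈ φ '' V ↔ x ∈ V := fun x =>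
    ⟨fun ⟨y, hy, h⟩ => hmem x y hy h.le, fun h => ⟨x, h, rfl⟩⟩
  have hFimg : IsFilter (φ '' V) :=
    { one_mem := ⟨1, hF.one_mem, hφ.map_one⟩
      mul_mem := by
        rintro _ _ ⟨x, hx, rfl⟩ ⟨y, hy, rfl⟩
        exact ⟨x * y, hF.mul_mem _ _ hx hy, hφ.map_mul x y⟩
      mem_of_le := by
        rintro _ y h ⟨x, hx, rfl⟩
        obtain ⟨y, rfl⟩ := hsurj y
        exact ⟨y, hmem y x hx h, rfl⟩ }
  have hval : IsValue (φ '' V) (φ g) := by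
    refine ⟨⟨hFimg, fun h => hV.1.2 ((himg g).1 h)⟩, ?_⟩
    rintro F ⟨hFF, hg⟩ hVF y hy
    obtain ⟨y, rfl⟩ := hsurj y
    have hsub : V ⊆ φ ⁻¹' F := Set.image_subset_iff.1 hVF
    exact ⟨y, hV.2 ⟨hφ.isFilter_preimage hFF, hg⟩ hsub hy, rfl⟩
  have hcov : ∀ x ∈ cover V g, φ x ∈ cover (φ '' V) (φ g) := by
    intro x hx F hFF hs
    refine hx _ (hφ.isFilter_preimage hFF) ?_
    rintro z (rfl | hz)
    · exact hs (Set.mem_insert _ _)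
    · exact hs (Set.mem_insert_of_mem _ ⟨z, hz, rfl⟩)
  intro x hx y hy
  have := hN _ _ hval _ (hcov x hx) _ (hcov y hy)
  rwa [← hφ.map_limp, ← hφ.map_rimp, himg, himg] at this

end Hom

/-! ### Maximum as a term -/

section Join

variable {M : Type*} [PseudoHoop M]

/-- A term that computes the maximum of two elements in every linearly ordered pseudo hoop. -/
def join (x y : M) : M :=
  (((x ⇾ y) ⇝ y) ⇾ ((y ⇾ x) ⇝ x)) * ((x ⇾ y) ⇝ y)

theorem join_comm (x y : M) : join x y = join y x := limp_mul_comm _ _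

theorem join_of_le {x y : M} (h : x ≤ y) : join x y = y := by
  have h' : y ≤ (y ⇾ x) ⇝ x := mul_le_iff_le_rimp.1 (limp_mul_le y x)
  rw [join, le_def.1 h, one_rimp, le_def.1 h', one_mul]

theorem IsHom.map_join {N : Type*} [PseudoHoop N] {φ : M → N} (hφ : IsHom φ) (x y : M) :
    φ (join x y) = join (φ x) (φ y) := by
  simp only [join, hφ.map_mul, hφ.map_limp, hφ.map_rimp]

end Join

/-! ### Primeness and the ultrafilter quotient -/

section Representable

variable {M : Type*} [PseudoHoop M] {ι : Type*} {C : ι → Type*} [∀ i, PseudoHoop (C i)]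
  {φ : M → ∀ i, C i}

theorem IsHom.le_iff (hφ : IsHom φ) (hinj : Function.Injective φ) {x y : M} :
    x ≤ y ↔ ∀ i, φ x i ≤ φ y i := by
  rw [le_def, ← hinj.eq_iff, hφ.map_limp, hφ.map_one, funext_iff]
  rfl

theorem IsHom.isBasic (hφ : IsHom φ) (hinj : Function.Injective φ) (hC : ∀ i, IsLinear (C i)) :
    IsBasic M := by
  refine ⟨fun x y z => (hφ.le_iff hinj).2 fun i => ?_,
    fun x y z => (hφ.le_iff hinj).2 fun i => ?_⟩
  · simp only [hφ.map_limp]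
    exact (hC i).isBasic.1 _ _ _
  · simp only [hφ.map_rimp]
    exact (hC i).isBasic.2 _ _ _

theorem IsHom.join_apply (hφ : IsHom φ) (x y : M) (i : ι) :
    φ (join x y) i = join (φ x i) (φ y i) := by
  rw [hφ.map_join]; rfl

/-- Values in a representable pseudo hoop are prime. -/
theorem IsHom.join_notMem (hφ : IsHom φ) (hinj : Function.Injective φ) (hC : ∀ i, IsLinear (C i))
    {V : Set M} {g : M} (hV : IsValue V g) {x y : M} (hx : x ∉ V) (hy : y ∉ V) :
    join x y ∉ V := by
  have hF : IsFilter V := hV.1.1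
  have hle : ∀ x y : M, x ≤ join x y := fun x y => (hφ.le_iff hinj).2 fun i => by
    rw [hφ.join_apply]
    rcases hC i (φ x i) (φ y i) with h | h
    · rwa [join_of_le h]
    · rw [join_comm, join_of_le h]
  have hmono : ∀ x y z : M, x ≤ y → join x z ≤ join y z := fun x y z hxy =>
    (hφ.le_iff hinj).2 fun i => by
      have hxy := (hφ.le_iff hinj).1 hxy i
      have hyl := (hφ.le_iff hinj).1 (hle y z) i
      have hzl := (hφ.le_iff hinj).1 (hle z y) i
      rw [join_comm] at hzl
      rw [hφ.join_apply x z]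
      rcases hC i (φ x i) (φ z i) with h | h
      · rwa [join_of_le h]
      · rw [join_comm, join_of_le h]; exact hxy.trans hyl
  have hmul : ∀ x y z : M, join x z * join y z ≤ join (x * y) z := fun x y z =>
    (hφ.le_iff hinj).2 fun i => by
      have hzl := (hφ.le_iff hinj).1 (hle z (x * y)) i
      have hl := (hφ.le_iff hinj).1 (hle (x * y) z) i
      rw [join_comm] at hzl
      rw [hφ.map_mul, Pi.mul_apply, hφ.join_apply x z, hφ.join_apply y z]
      rw [hφ.map_mul, Pi.mul_apply] at hl
      rcases hC i (φ x i) (φ z i) with h | h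
      · rw [join_of_le h]
        exact (mul_le_left _ _).trans hzl
      · rcases hC i (φ y i) (φ z i) with h' | h'
        · rw [join_of_le h']
          exact (mul_le_right _ _).trans hzl
        · rwa [join_comm, join_of_le h, join_comm, join_of_le h']
  -- By maximality of `V`, these filters allow `x`, then `y`, to be replaced by `g` in `join x y ∈
  -- V`.
  have hfil : ∀ z : M, IsFilter {w : M | join w z ∈ V} := fun z =>
    { one_mem := hF.mem_of_le _ _ (hle 1 z) hF.one_mem
      mul_mem := fun a b ha hb => hF.mem_of_le _ _ (hmul a b z) (hF.mul_mem _ _ ha hb)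
      mem_of_le := fun a b hab ha => hF.mem_of_le _ _ (hmono a b z hab) ha }
  have hsub : ∀ z : M, V ⊆ {w : M | join w z ∈ V} := fun z w hw => hF.mem_of_le _ _ (hle w z) hw
  intro hxy
  have hgy : join g y ∈ V := hV.mem_of_subset (hfil y) (hsub y) hxy hx
  rw [join_comm] at hgy
  have hgg : join g g ∈ V := hV.mem_of_subset (hfil g) (hsub g) hgy hy
  rw [join_of_le le_rfl] at hgg
  exact hV.1.2 hgg

/-- Equality of the coordinates almost everywhere with respect to `U`. -/
def eventualSetoid (U : Filter ι) (φ : M → ∀ i, C i) : Setoid M where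
  r x y := ∀ᶠ i in U, φ x i = φ y i
  iseqv :=
    { refl := fun _ => .of_forall fun _ => rfl
      symm := fun h => h.mono fun _ => Eq.symm
      trans := fun h h' => (h.and h').mono fun _ h => h.1.trans h.2 }

/-- The quotient of a subalgebra of a product by equality almost everywhere. -/
abbrev quotientPseudoHoop (U : Filter ι) (hφ : IsHom φ) :
    PseudoHoop (Quotient (eventualSetoid U φ)) where
  mul := Quotient.map₂ (· * ·) fun _ _ h _ _ h' => (h.and h').mono fun i h => by
    simp only [hφ.map_mul, Pi.mul_apply, h.1, h.2]
  one := Quotient.mk _ 1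
  limp := Quotient.map₂ (· ⇾ ·) fun _ _ h _ _ h' => (h.and h').mono fun i h => by
    simp only [hφ.map_limp]
    exact congrArg₂ limp h.1 h.2
  rimp := Quotient.map₂ (· ⇝ ·) fun _ _ h _ _ h' => (h.and h').mono fun i h => by
    simp only [hφ.map_rimp]
    exact congrArg₂ rimp h.1 h.2
  mul_one' := by rintro ⟨x⟩; exact congrArg (Quotient.mk _) (mul_one' x)
  one_mul' := by rintro ⟨x⟩; exact congrArg (Quotient.mk _) (one_mul' x)
  limp_self := by rintro ⟨x⟩; exact congrArg (Quotient.mk _) (limp_self x)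
  rimp_self := by rintro ⟨x⟩; exact congrArg (Quotient.mk _) (rimp_self x)
  mul_limp := by rintro ⟨x⟩ ⟨y⟩ ⟨z⟩; exact congrArg (Quotient.mk _) (mul_limp x y z)
  mul_rimp := by rintro ⟨x⟩ ⟨y⟩ ⟨z⟩; exact congrArg (Quotient.mk _) (mul_rimp x y z)
  limp_mul_comm := by rintro ⟨x⟩ ⟨y⟩; exact congrArg (Quotient.mk _) (limp_mul_comm x y)
  limp_mul_eq_mul_rimp := by
    rintro ⟨x⟩ ⟨y⟩; exact congrArg (Quotient.mk _) (limp_mul_eq_mul_rimp x y)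
  mul_rimp_comm := by rintro ⟨x⟩ ⟨y⟩; exact congrArg (Quotient.mk _) (mul_rimp_comm x y)

/-- There is an ultrafilter such that an element which is `1` almost everywhere lies in the given
value. -/
theorem IsHom.exists_ultrafilter (hφ : IsHom φ) (hinj : Function.Injective φ)
    (hC : ∀ i, IsLinear (C i)) {V : Set M} {g : M} (hV : IsValue V g) :
    ∃ U : Ultrafilter ι, ∀ x, (∀ᶠ i in U, φ x i = 1) → x ∈ V := by
  let B : {x : M // x ∉ V} → Set ι := fun x => {i | φ x i ≠ 1}
  have hdir : Directed (· ≥ ·) fun x => Filter.principal (B x) := by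
    rintro ⟨x, hx⟩ ⟨y, hy⟩
    refine ⟨⟨join x y, hφ.join_notMem hinj hC hV hx hy⟩, ?_, ?_⟩ <;>
      refine Filter.principal_mono.2 fun i hi h => hi ?_
    · change φ x i = 1 at h
      rw [hφ.join_apply, h, join_comm, join_of_le (le_one _)]
    · change φ y i = 1 at h
      rw [hφ.join_apply, h, join_of_le (le_one _)]
  have : Nonempty {x : M // x ∉ V} := ⟨⟨g, hV.1.2⟩⟩
  have : (⨅ x, Filter.principal (B x)).NeBot := by
    -- An empty `B x` would mean `x = 1`, which lies in `V`.
    refine Filter.iInf_neBot_of_directed' hdir fun x => Filter.principal_neBot_iff.2 ?_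
    by_contra h
    have h1 : φ x = φ 1 := by
      funext i
      rw [hφ.map_one]
      by_contra hi
      exact h ⟨i, hi⟩
    exact x.2 (hinj h1 ▸ hV.1.1.one_mem)
  refine ⟨Ultrafilter.of (⨅ x, Filter.principal (B x)), fun x hx => ?_⟩
  by_contra hxV
  have hB : ∀ᶠ i in Ultrafilter.of (⨅ x, Filter.principal (B x)), φ x i ≠ 1 :=
    Ultrafilter.of_le _ (Filter.mem_iInf_of_mem ⟨x, hxV⟩ (Filter.mem_principal_self _))
  obtain ⟨i, h, h'⟩ := (hx.and hB).exists
  exact h' h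

end Representable

end PseudoHoop

open PseudoHoop in
theorem corollary6p13 (M : Type u) [PseudoHoop M]
    (hM : PseudoHoop.IsRepresentable.{u, v, w} M) : PseudoHoop.IsNormalValued M := by
  obtain ⟨ι, C, _, φ, hC, hφ, hinj, -⟩ := hM
  refine ⟨hφ.isBasic hinj hC, fun V g hV => ?_⟩
  obtain ⟨U, hU⟩ := hφ.exists_ultrafilter hinj hC hV
  let _ := quotientPseudoHoop (U : Filter ι) hφ
  have hπ : IsHom (Quotient.mk (eventualSetoid (U : Filter ι) φ)) :=
    ⟨rfl, fun _ _ => rfl, fun _ _ => rfl, fun _ _ => rfl⟩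
  have hle : ∀ x y : M, (∀ᶠ i in (U : Filter ι), φ x i ≤ φ y i) →
      Quotient.mk (eventualSetoid (U : Filter ι) φ) (x ⇾ y) = Quotient.mk _ 1 := fun x y h =>
    have hxy : ∀ᶠ i in (U : Filter ι), φ (x ⇾ y) i = φ 1 i := h.mono fun i hi => by
      rw [hφ.map_limp, hφ.map_one]
      exact hi
    Quotient.sound (s := eventualSetoid (U : Filter ι) φ) hxy
  -- An ultrafilter decides which side of the coordinatewise disjunction holds almost everywhere.
  have hlin : IsLinear (Quotient (eventualSetoid (U : Filter ι) φ)) := by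
    rintro ⟨x⟩ ⟨y⟩
    exact (Ultrafilter.eventually_or.1 (.of_forall fun i => hC i (φ x i) (φ y i))).imp
      (hle x y) (hle y x)
  refine hπ.isNormalIn_cover Quotient.mk_surjective hV (fun x hx => hU x ?_)
    fun W h hW => hlin.isNormalIn_cover hW
  have h1 : ∀ᶠ i in (U : Filter ι), φ x i = φ 1 i := Quotient.exact hx
  rwa [hφ.map_one] at h1
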